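/- Let $\alpha>1$ and $b>0$ be real numbers and let $\nu\in\mathbb C$ satisfy $\nu\neq\pm\frac{\lambda}{2}$ for every $\lambda=0,1,2,\dots$ and $\operatorname{Re}\nu+1<\frac1{\alpha-1}$. Write $${}_1F_2(a;c,d;z)=\sum_{r=0}^\infty\frac{(a)_r}{(c)_r(d)_r}\frac{z^r}{r!},\qquad (a)_r=a(a+1)\cdots(a+r-1),\ (a)_0=1 .$$ Then the integral below converges absolutely, the three series ${}_1F_2$ below converge absolutely, and $$\begin{aligned} \int_0^\infty x^{\nu}\,[1+(\alpha-1)x]^{-\frac1{\alpha-1}}\,e^{-b x^{-1/2}}\,dx ={}&\frac{\Gamma\left(\frac1{\alpha-1}-1-\nu\right)\Gamma(1+\nu)}{(\alpha-1)^{\nu+1}\,\Gamma\left(\frac1{\alpha-1}\right)}\; {}_1F_2\left(\tfrac1{\alpha-1}-1-\nu;\ \tfrac12,\,-\nu;\ -\tfrac{(\alpha-1)b^2}{4}\right)\\ &-\frac{2\,\Gamma\left(\frac1{\alpha-1}-\frac12-\nu\right)\Gamma\left(\frac12+\nu\right)}{(\alpha-1)^{\nu+1}\,\Gamma\left(\frac1{\alpha-1}\right)}\left[\tfrac{(\alpha-1)b^2}{4}\right]^{\frac12}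 {}_1F_2\left(\tfrac1{\alpha-1}-\tfrac12-\nu;\ \tfrac32,\,\tfrac12-\nu;\ -\tfrac{(\alpha-1)b^2}{4}\right)\\ &+\frac{\pi^{-\frac12}\,\Gamma(-\nu-1)\,\Gamma\left(-\nu-\frac12\right)}{(\alpha-1)^{\nu+1}}\left[\tfrac{(\alpha-1)b^2}{4}\right]^{1+\nu} {}_1F_2\left(\tfrac1{\alpha-1};\ 2+\nu,\,\tfrac32+\nu;\ -\tfrac{(\alpha-1)b^2}{4}\right). \end{aligned}$$ Powers of positive reals are taken with the real logarithm. -/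

import Mathlib

/-- The `r`-th term `(a)_r / ((b₁)_r (b₂)_r) * z ^ r / r!` of the generalized hypergeometric
series `₁F₂(a; b₁, b₂; z)`, where `(a)_r = a (a + 1) ⋯ (a + r - 1)` is the rising factorial.
The series is meaningful when neither `b₁` nor `b₂` is one of `0, -1, -2, …`. -/
noncomputable def oneFTwoTerm (a b₁ b₂ z : ℂ) (r : ℕ) : ℂ :=
  (ascPochhammer ℂ r).eval a / ((ascPochhammer ℂ r).eval b₁ * (ascPochhammer ℂ r).eval b₂) *
    (z ^ r / (r.factorial : ℂ))

/-- The generalized hypergeometric function `₁F₂(a; b₁, b₂; z)`, as the sum of its series. -/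
noncomputable def oneFTwo (a b₁ b₂ z : ℂ) : ℂ :=
  ∑' r : ℕ, oneFTwoTerm a b₁ b₂ z r

/-- The integrand `x ^ ν * [1 + (α - 1) x] ^ (-1 / (α - 1)) * exp (-b x ^ (-1/2))` of the
extended (pathway) reaction probability integral, meant for `x > 0`. -/
noncomputable def extendedIntegrand (ν : ℂ) (α b x : ℝ) : ℂ :=
  (x : ℂ) ^ ν * (((1 + (α - 1) * x) ^ (-(1 / (α - 1))) : ℝ) : ℂ) *
    ((Real.exp (-b * x ^ (-(1 / 2) : ℝ)) : ℝ) : ℂ)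

/-!
The integral is a Mellin convolution of `(1 + x) ^ (-β)`, `β = 1 / (α - 1)`, with an exponential, and
the three hypergeometric series are what the residues of its Mellin–Barnes representation give. The
proof below obtains the residue series without a contour, from regularized Mellin transforms.

For `f x = ∑ aₘ xᵐ` near `0` and `c > 0` small, `regMellin a f c s` is
`∑ aₘ c ^ (s + m) / (s + m) + ∫_c^∞ x ^ (s - 1) f x dx`. It equals the ordinary Mellin transform for
`Re s > 0`, and integration by parts (`regMellin_eq_neg_regMellin_deriv_div`) relates its value at `s`
to that of `f'` at `s + 1`. Hence the evaluations
`B ^ (-s) Γ(s)` for `exp (-B x)` (`regMellin_exp`) and `Γ(s) Γ(β - s) / Γ(β)` for `(1 + x) ^ (-β)`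
(`regMellin_one_add_rpow`) persist for all non-integral `s` (with `Re s < β` in the second case).

After rescaling `x`, the integrand is `x ^ ν (1 + x) ^ (-β) exp (-B x ^ (-1/2))` with
`B ^ 2 = (α - 1) b ^ 2`. The integral is split at some `c < 1`. Over `(0, c)` the power of `1 + x` is
expanded, and each term is an incomplete gamma integral, i.e. a complete gamma value minus a series of
boundary terms. Over `(c, ∞)` the exponential is expanded, and each term is an incomplete beta integral,
i.e. a beta value minus a series of boundary terms. The two double series of boundary terms are
absolutely convergent and cancel (`integral_scaledIntegrand`). In what remains, the gamma values form
the third `₁F₂` by Legendre's duplication formula (`gamma_term_eq`), and the beta values with even and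
with odd index form the first and the second (`even_term_eq`, `odd_term_eq`).
-/

open MeasureTheory Set Filter Topology

/-! ### Integrating power series term by term -/

/-- Integration of `h * ∑ pₙ φⁿ` term by term, when `|φ| ≤ M` on the domain and `∑ |pₙ| Mⁿ`
converges. -/
theorem hasSum_setIntegral_mul_pow {S : Set ℝ} (hS : MeasurableSet S) {h F : ℝ → ℂ} {φ : ℝ → ℝ}
    {p : ℕ → ℂ} {M : ℝ} (hh : IntegrableOn h S) (hφ : Measurable φ)
    (hM : ∀ x ∈ S, |φ x| ≤ M) (hp : Summable fun n => ‖p n‖ * M ^ n)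
    (hF : ∀ x ∈ S, HasSum (fun n => p n * (φ x : ℂ) ^ n) (F x)) :
    HasSum (fun n => p n * ∫ x in S, h x * (φ x : ℂ) ^ n) (∫ x in S, h x * F x) := by
  have hpow : ∀ n : ℕ, ∀ x ∈ S, ‖(φ x : ℂ) ^ n‖ ≤ M ^ n := by
    intro n x hx
    rw [norm_pow, Complex.norm_real, Real.norm_eq_abs]
    exact pow_le_pow_left₀ (abs_nonneg _) (hM x hx) n
  have hint : ∀ n : ℕ, IntegrableOn (fun x => h x * (φ x : ℂ) ^ n) S := fun n =>
    Integrable.mul_bdd hh ((Complex.measurable_ofReal.comp hφ).pow_const n).aestronglyMeasurable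
      ((ae_restrict_mem hS).mono fun x hx => hpow n x hx)
  have key := hasSum_integral_of_summable_integral_norm (μ := volume.restrict S)
    (F := fun n x => p n * (h x * (φ x : ℂ) ^ n)) (fun n => (hint n).const_mul (p n)) ?_
  · simp only [integral_const_mul] at key
    have e : ∫ x in S, h x * F x = ∫ x in S, ∑' n, p n * (h x * (φ x : ℂ) ^ n) := by
      refine setIntegral_congr_fun hS fun x hx => ?_
      rw [← (hF x hx).tsum_eq, ← tsum_mul_left]
      exact tsum_congr fun n => by ring
    rw [e]
    exact key
  · refine Summable.of_nonneg_of_le (fun n => by positivity) (fun n => ?_)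
      (hp.mul_right (∫ x in S, ‖h x‖))
    simp only [norm_mul, integral_const_mul]
    rw [mul_assoc]
    gcongr
    rw [← integral_const_mul]
    refine setIntegral_mono_on (by simpa only [norm_mul, IntegrableOn] using (hint n).norm)
      (hh.norm.const_mul _) hS fun x hx => ?_
    rw [mul_comm]
    gcongr
    exact hpow n x hx

/-- A non-integral complex number stays at a positive distance from the integers. -/
theorem exists_pos_le_norm_add_intCast {s : ℂ} (hs : ∀ n : ℤ, s ≠ n) :
    ∃ δ > 0, ∀ n : ℤ, δ ≤ ‖s + n‖ := by
  have hcl : IsClosed (Set.range ((↑) : ℤ → ℂ)) := by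
    have := (Complex.isometry_ofReal.isClosedEmbedding.comp
      Real.isClosedEmbedding_intCast).isClosed_range
    simpa [Function.comp_def] using this
  have hmem : s ∉ Set.range ((↑) : ℤ → ℂ) := by
    rintro ⟨n, rfl⟩
    exact hs n rfl
  refine ⟨Metric.infDist s (Set.range ((↑) : ℤ → ℂ)),
    (hcl.notMem_iff_infDist_pos (Set.range_nonempty _)).1 hmem, fun n => ?_⟩
  have := Metric.infDist_le_dist_of_mem (x := s) (Set.mem_range_self (f := ((↑) : ℤ → ℂ)) (-n))
  simpa [dist_eq_norm] using this

/-! ### Regularized Mellin transforms -/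

/-- The Mellin transform `∫₀^∞ x ^ (s - 1) f x dx` of a function `f x = ∑ aₘ xᵐ`, with the part
over `(0, c)` replaced by the result `∑ aₘ c ^ (s + m) / (s + m)` of formal term by term
integration. It makes sense for every `s` outside `0, -1, -2, …`. -/
noncomputable def regMellin (a : ℕ → ℂ) (f : ℝ → ℂ) (c : ℝ) (s : ℂ) : ℂ :=
  ∑' m : ℕ, a m * ((c : ℂ) ^ (s + m) / (s + m)) + ∫ x in Ioi c, (x : ℂ) ^ (s - 1) * f x

theorem add_natCast_ne_zero_of_ne_intCast {s : ℂ} (hs : ∀ n : ℤ, s ≠ n) (m : ℕ) :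
    s + m ≠ 0 := by
  intro h
  apply hs (-m)
  push_cast
  linear_combination h

theorem summable_mul_cpow_div {a : ℕ → ℂ} {c : ℝ} {s : ℂ} (hc : 0 < c) (hs : ∀ n : ℤ, s ≠ n)
    (ha : Summable fun m => ‖a m‖ * c ^ m) :
    Summable fun m : ℕ => a m * ((c : ℂ) ^ (s + m) / (s + m)) := by
  obtain ⟨δ, hδ, h⟩ := exists_pos_le_norm_add_intCast hs
  refine Summable.of_norm_bounded (ha.mul_right (c ^ s.re / δ)) fun m => ?_
  rw [norm_mul, norm_div, Complex.norm_cpow_eq_rpow_re_of_pos hc, mul_assoc]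
  gcongr
  rw [Complex.add_re, Complex.natCast_re, Real.rpow_add hc, Real.rpow_natCast, mul_comm,
    mul_div_assoc]
  gcongr
  exact_mod_cast h m

/-- In the half-plane where the Mellin integral converges at `0`, nothing is regularized. -/
theorem regMellin_eq_integral {a : ℕ → ℂ} {f : ℝ → ℂ} {c : ℝ} {s : ℂ} (hc : 0 < c)
    (hs : 0 < s.re) (ha : Summable fun m => ‖a m‖ * c ^ m)
    (hf : ∀ x ∈ Ioc 0 c, HasSum (fun m => a m * (x : ℂ) ^ m) (f x))
    (hint : IntegrableOn (fun x : ℝ => (x : ℂ) ^ (s - 1) * f x) (Ioi 0)) :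
    regMellin a f c s = ∫ x in Ioi (0 : ℝ), (x : ℂ) ^ (s - 1) * f x := by
  have hre : -1 < (s - 1).re := by simpa using hs
  have hh : IntegrableOn (fun x : ℝ => (x : ℂ) ^ (s - 1)) (Ioc 0 c) := by
    have := (intervalIntegral.intervalIntegrable_cpow' (a := 0) (b := c) hre)
    rwa [intervalIntegrable_iff_integrableOn_Ioc_of_le hc.le] at this
  have key := hasSum_setIntegral_mul_pow measurableSet_Ioc hh measurable_id
    (M := c) (fun x hx => by simpa [abs_of_pos hx.1] using hx.2) ha hf
  rw [regMellin, ← Ioc_union_Ioi_eq_Ioi hc.le, setIntegral_union Ioc_disjoint_Ioi_same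
    measurableSet_Ioi (hint.mono_set Ioc_subset_Ioi_self)
    (hint.mono_set (Ioi_subset_Ioi hc.le)), ← key.tsum_eq]
  congr 1
  refine tsum_congr fun m => ?_
  congr 1
  have hm : 0 < (s + m).re := by
    rw [Complex.add_re, Complex.natCast_re]; positivity
  have h0 : s + m ≠ 0 := fun h => by simp [h] at hm
  have e : ∫ x in Ioc 0 c, (x : ℂ) ^ (s - 1) * ((id x : ℝ) : ℂ) ^ m =
      ∫ x in Ioc 0 c, (x : ℂ) ^ (s + m - 1) := by
    refine setIntegral_congr_fun measurableSet_Ioc fun x hx => ?_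
    have hx0 : (x : ℂ) ≠ 0 := by exact_mod_cast hx.1.ne'
    simp only [id]
    rw [← Complex.cpow_natCast, ← Complex.cpow_add _ _ hx0]
    ring_nf
  rw [e, ← intervalIntegral.integral_of_le hc.le, integral_cpow (Or.inl (by simpa using hm))]
  simp [Complex.zero_cpow h0]

/-- Integration by parts. Iterating it moves `s` into the half-plane where
`regMellin_eq_integral` applies, which evaluates the regularized transform. -/
theorem regMellin_eq_neg_regMellin_deriv_div {a a' : ℕ → ℂ} {f f' : ℝ → ℂ} {c : ℝ} {s : ℂ}
    (hc : 0 < c) (hs : ∀ n : ℤ, s ≠ n) (ha : Summable fun m => ‖a m‖ * c ^ m)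
    (hf : HasSum (fun m => a m * (c : ℂ) ^ m) (f c))
    (haa' : ∀ m : ℕ, a' m = (m + 1) * a (m + 1))
    (hff' : ∀ x ∈ Ici c, HasDerivAt f (f' x) x)
    (hint : IntegrableOn (fun x : ℝ => (x : ℂ) ^ (s - 1) * f x) (Ioi c))
    (hint' : IntegrableOn (fun x : ℝ => (x : ℂ) ^ s * f' x) (Ioi c))
    (hlim : Tendsto (fun x : ℝ => (x : ℂ) ^ s * f x) atTop (𝓝 0)) :
    regMellin a f c s = -regMellin a' f' c (s + 1) / s := by
  have hs0 : s ≠ 0 := by simpa using hs 0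
  have hc0 : (c : ℂ) ≠ 0 := by exact_mod_cast hc.ne'
  have hu : ∀ x ∈ Ici c, HasDerivAt (fun y : ℝ => (y : ℂ) ^ s / s) ((x : ℂ) ^ (s - 1)) x := by
    intro x hx
    have := hasDerivAt_ofReal_cpow_const' (x := x) (r := s - 1) (hc.trans_le hx).ne'
      (by intro h; apply hs0; linear_combination h)
    simpa using this
  have hparts : ∫ x in Ioi c, (x : ℂ) ^ s / s * f' x =
      0 - (c : ℂ) ^ s / s * f c - ∫ x in Ioi c, (x : ℂ) ^ (s - 1) * f x := by
    refine integral_Ioi_mul_deriv_eq_deriv_mul (u := fun y : ℝ => (y : ℂ) ^ s / s) (v := f)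
      (fun x hx => hu x (mem_Ici.2 (le_of_lt hx)))
      (fun x hx => hff' x (mem_Ici.2 (le_of_lt hx))) ?_ hint ?_ ?_
    · refine IntegrableOn.congr_fun (hint'.const_mul s⁻¹) (fun x _ => ?_) measurableSet_Ioi
      simp only [Pi.mul_apply]
      ring
    · exact ((hu c self_mem_Ici).continuousAt.mul
        (hff' c self_mem_Ici).continuousAt).tendsto.mono_left nhdsWithin_le_nhds
    · have := hlim.const_mul s⁻¹
      rw [mul_zero] at this
      refine this.congr fun x => ?_
      simp only [Pi.mul_apply]
      ring
  have hser : ∑' m : ℕ, a' m * ((c : ℂ) ^ (s + 1 + m) / (s + 1 + m)) =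
      (c : ℂ) ^ s * f c - s * ∑' m : ℕ, a m * ((c : ℂ) ^ (s + m) / (s + m)) := by
    have h1 := (hf.mul_left ((c : ℂ) ^ s)).sub
      ((summable_mul_cpow_div hc hs ha).hasSum.mul_left s)
    rw [← h1.tsum_eq, h1.summable.tsum_eq_zero_add]
    have h0 : (c : ℂ) ^ s * (a 0 * (c : ℂ) ^ 0) -
        s * (a 0 * ((c : ℂ) ^ (s + (0 : ℕ)) / (s + (0 : ℕ)))) = 0 := by
      simp only [Nat.cast_zero, add_zero, pow_zero]
      field_simp
      ring
    rw [h0, zero_add]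
    refine tsum_congr fun m => ?_
    have hm := add_natCast_ne_zero_of_ne_intCast hs (m + 1)
    have e1 : s + 1 + m = s + ((m + 1 : ℕ) : ℂ) := by push_cast; ring
    rw [haa', e1, Complex.cpow_add _ _ hc0, Complex.cpow_natCast]
    field_simp
    push_cast
    ring
  have hI : ∫ x in Ioi c, (x : ℂ) ^ (s + 1 - 1) * f' x =
      s * ∫ x in Ioi c, (x : ℂ) ^ s / s * f' x := by
    rw [← integral_const_mul]
    refine setIntegral_congr_fun measurableSet_Ioi fun x _ => ?_
    simp only [add_sub_cancel_right]
    field_simp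
  rw [regMellin, regMellin, hser, hI, hparts]
  field_simp
  ring

theorem regMellin_const_mul (k : ℂ) (a : ℕ → ℂ) (f : ℝ → ℂ) (c : ℝ) (s : ℂ) :
    regMellin (fun m => k * a m) (fun x => k * f x) c s = k * regMellin a f c s := by
  rw [regMellin, regMellin, mul_add, ← tsum_mul_left, ← integral_const_mul]
  congr 1
  · exact tsum_congr fun m => by ring
  · exact integral_congr_ae (Eventually.of_forall fun x => by ring)

theorem continuousOn_ofReal_cpow (s : ℂ) : ContinuousOn (fun x : ℝ => (x : ℂ) ^ s) (Ioi 0) :=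
  fun x hx => (Complex.continuousAt_ofReal_cpow_const x s
    (Or.inr (ne_of_gt hx))).continuousWithinAt

/-- Integrability at infinity suffices for the Mellin integrand when `Re s > 0`. -/
theorem integrableOn_Ioi_zero_cpow_mul {f : ℝ → ℂ} {c : ℝ} {s : ℂ} (hc : 0 < c) (hs : 0 < s.re)
    (hf : ContinuousOn f (Icc 0 c))
    (hint : IntegrableOn (fun x : ℝ => (x : ℂ) ^ (s - 1) * f x) (Ioi c)) :
    IntegrableOn (fun x : ℝ => (x : ℂ) ^ (s - 1) * f x) (Ioi 0) := by
  rw [← Ioc_union_Ioi_eq_Ioi hc.le]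
  refine IntegrableOn.union ?_ hint
  have h1 : IntegrableOn (fun x : ℝ => (x : ℂ) ^ (s - 1)) (Icc 0 c) := by
    rw [integrableOn_Icc_iff_integrableOn_Ioc,
      ← intervalIntegrable_iff_integrableOn_Ioc_of_le hc.le]
    exact intervalIntegral.intervalIntegrable_cpow' (by simpa using hs)
  exact (h1.mul_continuousOn hf isCompact_Icc).mono_set Ioc_subset_Icc_self

/-! ### The exponential function -/

/-- The Taylor coefficients of `exp (-B x)`. -/
noncomputable def expCoeff (B : ℝ) (k : ℕ) : ℂ :=
  (-(B : ℂ)) ^ k / (k.factorial : ℂ)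

theorem hasSum_expCoeff (B x : ℝ) :
    HasSum (fun k => expCoeff B k * (x : ℂ) ^ k) ((Real.exp (-B * x) : ℝ) : ℂ) := by
  have h := NormedSpace.expSeries_div_hasSum_exp (𝔸 := ℂ) (((-B * x : ℝ)) : ℂ)
  rw [← Complex.exp_eq_exp_ℂ, ← Complex.ofReal_exp] at h
  have e : (fun k => expCoeff B k * (x : ℂ) ^ k) =
      fun k => ((-B * x : ℝ) : ℂ) ^ k / (k.factorial : ℂ) := by
    funext k
    rw [expCoeff]
    push_cast
    rw [mul_pow, div_mul_eq_mul_div]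
  rw [e]
  exact h

theorem summable_norm_expCoeff (B M : ℝ) : Summable fun k => ‖expCoeff B k‖ * M ^ k := by
  have h := Real.summable_pow_div_factorial (|B| * M)
  refine h.congr fun k => ?_
  rw [expCoeff, norm_div, norm_pow, norm_neg, Complex.norm_real, Real.norm_eq_abs, mul_pow,
    RCLike.norm_natCast]
  ring

theorem integrableOn_cpow_mul_exp {B c : ℝ} (hB : 0 < B) (hc : 0 < c) (s : ℂ) :
    IntegrableOn (fun x : ℝ => (x : ℂ) ^ s * ((Real.exp (-B * x) : ℝ) : ℂ)) (Ioi c) := by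
  have hcont : ContinuousOn (fun x : ℝ => (x : ℂ) ^ s * ((Real.exp (-B * x) : ℝ) : ℂ)) (Ioi c) :=
    ((continuousOn_ofReal_cpow s).mono (Ioi_subset_Ioi hc.le)).mul (by fun_prop)
  have hreal : IntegrableOn (fun x : ℝ => x ^ s.re * Real.exp (-B * x)) (Ioi c) := by
    refine integrable_of_isBigO_exp_neg (half_pos hB) ?_ ?_
    · refine ContinuousOn.mul (fun x hx => ?_) (by fun_prop)
      exact (Real.continuousAt_rpow_const x _
        (Or.inl (hc.trans_le hx).ne')).continuousWithinAt
    · have := (isLittleO_rpow_exp_pos_mul_atTop s.re (half_pos hB)).isBigO.mul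
        (Asymptotics.isBigO_refl (fun x : ℝ => Real.exp (-B * x)) atTop)
      refine this.congr_right fun x => ?_
      rw [← Real.exp_add]
      ring_nf
  refine Integrable.mono' hreal (hcont.aestronglyMeasurable measurableSet_Ioi) ?_
  refine (ae_restrict_mem measurableSet_Ioi).mono fun x hx => ?_
  rw [norm_mul, Complex.norm_cpow_eq_rpow_re_of_pos (hc.trans hx), Complex.norm_real,
    Real.norm_eq_abs, abs_of_pos (Real.exp_pos _)]

/-- The regularized Mellin transform of `exp (-B x)` continues `B ^ (-s) Γ(s)` past the poles. -/
theorem regMellin_exp {B c : ℝ} (hB : 0 < B) (hc : 0 < c) {s : ℂ} (hs : ∀ n : ℤ, s ≠ n) :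
    regMellin (expCoeff B) (fun x => ((Real.exp (-B * x) : ℝ) : ℂ)) c s =
      (B : ℂ) ^ (-s) * Complex.Gamma s := by
  have hB0 : (B : ℂ) ≠ 0 := by exact_mod_cast hB.ne'
  obtain ⟨n, hn⟩ := exists_nat_gt (-s.re)
  induction n generalizing s with
  | zero =>
    have hs' : 0 < s.re := by simpa using hn
    rw [regMellin_eq_integral hc hs' (summable_norm_expCoeff B c)
      (fun x _ => hasSum_expCoeff B x) (integrableOn_Ioi_zero_cpow_mul hc hs' (by fun_prop)
        (integrableOn_cpow_mul_exp hB hc _))]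
    have := Complex.integral_cpow_mul_exp_neg_mul_Ioi hs' hB
    rw [one_div, Complex.inv_cpow _ _ (by
      rw [Complex.arg_ofReal_of_nonneg hB.le]; exact Real.pi_pos.ne), ← Complex.cpow_neg] at this
    rw [← this]
    refine setIntegral_congr_fun measurableSet_Ioi fun x _ => ?_
    push_cast
    simp only [neg_mul]
  | succ n ih =>
    have hs0 : s ≠ 0 := by simpa using hs 0
    have hs1 : ∀ n : ℤ, s + 1 ≠ n := by
      intro k hk
      apply hs (k - 1)
      push_cast
      linear_combination hk
    rw [regMellin_eq_neg_regMellin_deriv_div (a' := fun m => -(B : ℂ) * expCoeff B m)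
      (f' := fun x => -(B : ℂ) * ((Real.exp (-B * x) : ℝ) : ℂ)) hc hs
      (summable_norm_expCoeff B c) (hasSum_expCoeff B c) ?_ ?_
      (integrableOn_cpow_mul_exp hB hc _) ?_ ?_, regMellin_const_mul,
      ih hs1 (by simp at hn ⊢; linarith), Complex.Gamma_add_one s hs0, neg_add,
      Complex.cpow_add _ _ hB0, Complex.cpow_neg_one]
    · field_simp
    · intro m
      have := Nat.cast_add_one_ne_zero (R := ℂ) m
      rw [expCoeff, expCoeff, Nat.factorial_succ, pow_succ]
      push_cast
      field_simp
    · intro x _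
      have h : HasDerivAt (fun x : ℝ => Real.exp (-B * x)) (-B * Real.exp (-B * x)) x := by
        have := ((hasDerivAt_id x).const_mul (-B)).exp
        simpa [mul_comm] using this
      simpa using h.ofReal_comp
    · refine IntegrableOn.congr_fun ((integrableOn_cpow_mul_exp hB hc s).const_mul (-(B : ℂ)))
        (fun x _ => ?_) measurableSet_Ioi
      ring
    · rw [tendsto_zero_iff_norm_tendsto_zero]
      refine (tendsto_rpow_mul_exp_neg_mul_atTop_nhds_zero s.re B hB).congr' ?_
      filter_upwards [eventually_gt_atTop 0] with x hx
      rw [norm_mul, Complex.norm_cpow_eq_rpow_re_of_pos hx, Complex.norm_real,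
        Real.norm_eq_abs, abs_of_pos (Real.exp_pos _)]

/-! ### Negative powers of `1 + x` -/

/-- The Taylor coefficients of `(1 + x) ^ (-β)`. -/
noncomputable def binCoeff (β : ℝ) (m : ℕ) : ℂ :=
  (-1) ^ m * (ascPochhammer ℂ m).eval (β : ℂ) / (m.factorial : ℂ)

theorem binCoeff_eq_choose (β : ℝ) (m : ℕ) : binCoeff β m = Ring.choose (-(β : ℂ)) m := by
  have h0 : (m.factorial : ℂ) ≠ 0 := by exact_mod_cast m.factorial_ne_zero
  have h := Ring.factorial_nsmul_multichoose_eq_ascPochhammer (β : ℂ) m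
  rw [Polynomial.ascPochhammer_smeval_eq_eval, nsmul_eq_mul] at h
  rw [Ring.choose_neg', binCoeff, ← h, Units.smul_def, Int.coe_negOnePow_natCast, zsmul_eq_mul]
  push_cast
  field_simp

theorem hasSum_binCoeff (β : ℝ) {x : ℝ} (hx : |x| < 1) :
    HasSum (fun m => binCoeff β m * (x : ℂ) ^ m) (((1 + x) ^ (-β) : ℝ) : ℂ) := by
  have h := (Complex.one_add_cpow_hasFPowerSeriesOnBall_zero (a := -(β : ℂ))).hasSum
    (y := (x : ℂ)) (by
      rw [Metric.mem_eball, edist_zero_right, ← ofReal_norm, Complex.norm_real, Real.norm_eq_abs]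
      exact ENNReal.ofReal_lt_one.2 hx)
  have h1 : 0 ≤ 1 + x := by linarith [neg_abs_le x]
  rw [Complex.ofReal_cpow h1]
  simpa [binomialSeries, binCoeff_eq_choose, mul_comm] using h

theorem summable_norm_binCoeff (β : ℝ) {c : ℝ} (hc : 0 < c) (hc1 : c < 1) :
    Summable fun m => ‖binCoeff β m‖ * c ^ m := by
  have := (hasSum_binCoeff β (x := c) (by rwa [abs_of_pos hc])).summable.norm
  simpa [abs_of_pos hc] using this

theorem norm_cpow_mul_one_add_rpow_le {β x : ℝ} (hβ : 0 ≤ β) (hx : 0 < x) (s : ℂ) :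
    ‖(x : ℂ) ^ s * (((1 + x) ^ (-β) : ℝ) : ℂ)‖ ≤ x ^ (s.re - β) := by
  rw [norm_mul, Complex.norm_cpow_eq_rpow_re_of_pos hx, Complex.norm_real, Real.norm_eq_abs,
    abs_of_nonneg (by positivity), sub_eq_add_neg, Real.rpow_add hx]
  exact mul_le_mul_of_nonneg_left
    (Real.rpow_le_rpow_of_nonpos hx (by linarith) (by linarith)) (by positivity)

theorem integrableOn_cpow_mul_one_add_rpow {β c : ℝ} (hβ : 0 ≤ β) (hc : 0 < c) {s : ℂ}
    (hs : s.re + 1 < β) :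
    IntegrableOn (fun x : ℝ => (x : ℂ) ^ s * (((1 + x) ^ (-β) : ℝ) : ℂ)) (Ioi c) := by
  have hcont : ContinuousOn (fun x : ℝ => (x : ℂ) ^ s * (((1 + x) ^ (-β) : ℝ) : ℂ)) (Ioi c) := by
    refine ((continuousOn_ofReal_cpow s).mono (Ioi_subset_Ioi hc.le)).mul
      (Complex.continuous_ofReal.comp_continuousOn
        (ContinuousOn.rpow_const (by fun_prop) fun x hx => Or.inl ?_))
    have : 0 < x := hc.trans hx
    positivity
  refine Integrable.mono' (integrableOn_Ioi_rpow_of_lt (a := s.re - β) (by linarith) hc)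
    (hcont.aestronglyMeasurable measurableSet_Ioi) ?_
  exact (ae_restrict_mem measurableSet_Ioi).mono fun x hx =>
    norm_cpow_mul_one_add_rpow_le hβ (hc.trans hx) s

/-- The beta integral over the half-line. -/
theorem integral_cpow_mul_one_add_rpow {β : ℝ} {s : ℂ} (hs : 0 < s.re) (hsβ : s.re < β) :
    ∫ x in Ioi (0 : ℝ), (x : ℂ) ^ (s - 1) * (((1 + x) ^ (-β) : ℝ) : ℂ) =
      Complex.Gamma s * Complex.Gamma (β - s) / Complex.Gamma β := by
  have hbeta := Complex.betaIntegral_eq_Gamma_mul_div s (β - s) hs (by simpa using hsβ)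
  rw [add_sub_cancel] at hbeta
  rw [← hbeta, Complex.betaIntegral, intervalIntegral.integral_of_le zero_le_one,
    integral_Ioc_eq_integral_Ioo]
  -- The substitution `x = t / (1 - t)` leads back to the beta integral over `(0, 1)`.
  have himg : (fun t : ℝ => t / (1 - t)) '' Ioo 0 1 = Ioi 0 := by
    ext y
    constructor
    · rintro ⟨t, ht, rfl⟩
      exact div_pos ht.1 (by linarith [ht.2])
    · intro hy
      have hy : 0 < y := hy
      refine ⟨y / (1 + y), ⟨by positivity, by rw [div_lt_one (by positivity)]; linarith⟩, ?_⟩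
      simp only
      field_simp
      ring
  have hder : ∀ t ∈ Ioo (0 : ℝ) 1, HasDerivWithinAt (fun t : ℝ => t / (1 - t))
      (1 / (1 - t) ^ 2) (Ioo 0 1) t := by
    intro t ht
    have h1 : 1 - t ≠ 0 := by linarith [ht.2]
    have := ((hasDerivAt_id t).div ((hasDerivAt_id t).const_sub 1) h1).hasDerivWithinAt
      (s := Ioo 0 1)
    convert! this using 1
    simp
  have hinj : InjOn (fun t : ℝ => t / (1 - t)) (Ioo 0 1) := by
    intro t ht u hu (h : t / (1 - t) = u / (1 - u))
    have h1 : 1 - t ≠ 0 := by linarith [ht.2]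
    have h2 : 1 - u ≠ 0 := by linarith [hu.2]
    rw [div_eq_div_iff h1 h2] at h
    linarith
  rw [← himg, integral_image_eq_integral_abs_deriv_smul measurableSet_Ioo hder hinj]
  refine setIntegral_congr_fun measurableSet_Ioo fun t ht => ?_
  have ht0 : 0 < t := ht.1
  have h1 : 0 < 1 - t := by linarith [ht.2]
  have h1c : ((1 - t : ℝ) : ℂ) ≠ 0 := by exact_mod_cast h1.ne'
  have e1 : 1 + t / (1 - t) = (1 - t)⁻¹ := by field_simp; ring
  rw [abs_of_pos (by positivity), e1, Real.inv_rpow h1.le, Real.rpow_neg h1.le, inv_inv,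
    Complex.ofReal_cpow h1.le, Complex.ofReal_div,
    ← Complex.ofReal_one, ← Complex.ofReal_sub, Complex.div_cpow_ofReal_nonneg ht0.le h1.le]
  -- The powers of `1 - t` come from `x ^ (s - 1)`, the remaining beta factor, and the Jacobian.
  have e2 : (β : ℂ) = (β - s - 1) + (s - 1) + 2 := by ring
  have e3 : ((1 - t : ℝ) : ℂ) ^ (β : ℂ) = ((1 - t : ℝ) : ℂ) ^ ((β : ℂ) - s - 1) *
      ((1 - t : ℝ) : ℂ) ^ (s - 1) * ((1 - t : ℝ) : ℂ) ^ 2 := by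
    conv_lhs => rw [e2]
    rw [Complex.cpow_add _ _ h1c, Complex.cpow_add _ _ h1c, Complex.cpow_ofNat]
  have h2 : ((1 - t : ℝ) : ℂ) ^ (s - 1) ≠ 0 :=
    fun h => h1c ((Complex.cpow_eq_zero_iff _ _).1 h).1
  rw [e3, Complex.real_smul, Complex.ofReal_div, Complex.ofReal_pow, Complex.ofReal_one]
  field_simp

/-- The regularized Mellin transform of `(1 + x) ^ (-β)` continues the beta integral. Differentiation
raises `β` by one along with `s`, so the condition `Re s < β` survives the induction. -/
theorem regMellin_one_add_rpow {c : ℝ} (hc : 0 < c) (hc1 : c < 1) {β : ℝ} (hβ : 0 < β) {s : ℂ}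
    (hs : ∀ n : ℤ, s ≠ n) (hsβ : s.re < β) :
    regMellin (binCoeff β) (fun x => (((1 + x) ^ (-β) : ℝ) : ℂ)) c s =
      Complex.Gamma s * Complex.Gamma (β - s) / Complex.Gamma β := by
  obtain ⟨n, hn⟩ := exists_nat_gt (-s.re)
  induction n generalizing s β with
  | zero =>
    have hs' : 0 < s.re := by simpa using hn
    rw [regMellin_eq_integral hc hs' (summable_norm_binCoeff β hc hc1)
      (fun x hx => hasSum_binCoeff β
        (by rw [abs_of_pos hx.1]; exact hx.2.trans_lt hc1))
      (integrableOn_Ioi_zero_cpow_mul hc hs' ?_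
        (integrableOn_cpow_mul_one_add_rpow hβ.le hc (by simpa using hsβ))),
      integral_cpow_mul_one_add_rpow hs' hsβ]
    refine Complex.continuous_ofReal.comp_continuousOn
      (ContinuousOn.rpow_const (by fun_prop) fun x hx => Or.inl ?_)
    linarith [hx.1]
  | succ n ih =>
    have hs0 : s ≠ 0 := by simpa using hs 0
    have hs1 : ∀ n : ℤ, s + 1 ≠ n := by
      intro k hk
      apply hs (k - 1)
      push_cast
      linear_combination hk
    have hβ0 : (β : ℂ) ≠ 0 := by exact_mod_cast hβ.ne'
    have hre : (s - 1).re + 1 < β := by simpa using hsβ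
    rw [regMellin_eq_neg_regMellin_deriv_div (a' := fun m => -(β : ℂ) * binCoeff (β + 1) m)
      (f' := fun x => -(β : ℂ) * (((1 + x) ^ (-(β + 1)) : ℝ) : ℂ)) hc hs
      (summable_norm_binCoeff β hc hc1) (hasSum_binCoeff β (by rwa [abs_of_pos hc])) ?_ ?_
      (integrableOn_cpow_mul_one_add_rpow hβ.le hc hre) ?_ ?_, regMellin_const_mul,
      ih (by positivity) hs1 (by simpa using hsβ) (by simp at hn ⊢; linarith),
      Complex.Gamma_add_one s hs0, Complex.ofReal_add, Complex.ofReal_one,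
      Complex.Gamma_add_one _ hβ0, add_sub_add_right_eq_sub]
    · field_simp
    · intro m
      have := Nat.cast_add_one_ne_zero (R := ℂ) m
      rw [binCoeff, binCoeff, Nat.factorial_succ, pow_succ, ascPochhammer_succ_left]
      simp only [Polynomial.eval_mul, Polynomial.eval_X, Polynomial.eval_comp,
        Polynomial.eval_add, Polynomial.eval_one]
      push_cast
      field_simp
    · intro x hx
      have hx0 : 0 < 1 + x := by have : c ≤ x := hx; linarith
      have h : HasDerivAt (fun x : ℝ => (1 + x) ^ (-β)) (-β * (1 + x) ^ (-(β + 1))) x := by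
        have := ((hasDerivAt_id x).const_add 1).rpow_const (p := -β) (Or.inl hx0.ne')
        rwa [one_mul, ← neg_add'] at this
      simpa using h.ofReal_comp
    · refine IntegrableOn.congr_fun ((integrableOn_cpow_mul_one_add_rpow (β := β + 1) (s := s)
        (by positivity) hc (by linarith)).const_mul (-(β : ℂ))) (fun x _ => ?_) measurableSet_Ioi
      ring
    · refine squeeze_zero_norm' (a := fun x : ℝ => x ^ (-(β - s.re))) ?_
        (tendsto_rpow_neg_atTop (by linarith))
      filter_upwards [eventually_gt_atTop 0] with x hx
      simpa using norm_cpow_mul_one_add_rpow_le hβ.le hx s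

/-! ### The two convergent series for the integral -/

theorem ofReal_rpow_cpow {x : ℝ} (hx : 0 < x) (r : ℝ) (μ : ℂ) :
    ((x ^ r : ℝ) : ℂ) ^ μ = (x : ℂ) ^ ((r : ℂ) * μ) := by
  have h1 : ((x ^ r : ℝ) : ℂ) ≠ 0 := by exact_mod_cast (Real.rpow_pos_of_pos hx r).ne'
  have h2 : (x : ℂ) ≠ 0 := by exact_mod_cast hx.ne'
  rw [Complex.cpow_def_of_ne_zero h1, Complex.cpow_def_of_ne_zero h2, ← Complex.ofReal_log hx.le,
    ← Complex.ofReal_log (Real.rpow_pos_of_pos hx r).le, Real.log_rpow hx]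
  push_cast
  ring_nf

theorem image_rpow_neg_two_Ioi {c : ℝ} (hc : 0 < c) :
    (fun y : ℝ => y ^ (-2 : ℝ)) '' Ioi (c ^ (-(1 / 2) : ℝ)) = Ioo 0 c := by
  have hd : 0 < c ^ (-(1 / 2) : ℝ) := Real.rpow_pos_of_pos hc _
  have hcd : (c ^ (-(1 / 2) : ℝ)) ^ (-2 : ℝ) = c := by
    rw [← Real.rpow_mul hc.le]; norm_num
  ext x
  constructor
  · rintro ⟨y, hy, rfl⟩
    refine ⟨Real.rpow_pos_of_pos (hd.trans hy) _, ?_⟩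
    have := Real.rpow_lt_rpow_of_neg hd hy (show (-2 : ℝ) < 0 by norm_num)
    rwa [hcd] at this
  · rintro ⟨hx, hxc⟩
    refine ⟨x ^ (-(1 / 2) : ℝ), Real.rpow_lt_rpow_of_neg hx hxc (by norm_num), ?_⟩
    change (x ^ (-(1 / 2) : ℝ)) ^ (-2 : ℝ) = x
    rw [← Real.rpow_mul hx.le]; norm_num

/-- The substitution `x = y ^ (-2)`, which takes `(0, c)` to `(c ^ (-1/2), ∞)`. -/
theorem substitution_rpow_neg_two {c : ℝ} (hc : 0 < c) (μ : ℂ) (g : ℝ → ℂ) :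
    (IntegrableOn (fun x : ℝ => (x : ℂ) ^ μ * g (x ^ (-(1 / 2) : ℝ))) (Ioo 0 c) ↔
      IntegrableOn (fun y : ℝ => 2 * ((y : ℂ) ^ (-2 * (μ + 1) - 1) * g y))
        (Ioi (c ^ (-(1 / 2) : ℝ)))) ∧
    ∫ x in Ioo 0 c, (x : ℂ) ^ μ * g (x ^ (-(1 / 2) : ℝ)) =
      2 * ∫ y in Ioi (c ^ (-(1 / 2) : ℝ)), (y : ℂ) ^ (-2 * (μ + 1) - 1) * g y := by
  have hd : 0 < c ^ (-(1 / 2) : ℝ) := Real.rpow_pos_of_pos hc _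
  have hder : ∀ y ∈ Ioi (c ^ (-(1 / 2) : ℝ)), HasDerivWithinAt (fun y : ℝ => y ^ (-2 : ℝ))
      (-2 * y ^ (-2 - 1 : ℝ)) (Ioi (c ^ (-(1 / 2) : ℝ))) y := fun y hy =>
    (Real.hasDerivAt_rpow_const (Or.inl (hd.trans hy).ne')).hasDerivWithinAt
  have hinj : InjOn (fun y : ℝ => y ^ (-2 : ℝ)) (Ioi (c ^ (-(1 / 2) : ℝ))) :=
    (Real.rpow_left_injOn (by norm_num)).mono fun y hy => (hd.trans hy).le
  have e : ∀ y ∈ Ioi (c ^ (-(1 / 2) : ℝ)),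
      |(-2 * y ^ (-2 - 1 : ℝ))| • (((y ^ (-2 : ℝ) : ℝ) : ℂ) ^ μ *
        g ((y ^ (-2 : ℝ)) ^ (-(1 / 2) : ℝ))) = 2 * ((y : ℂ) ^ (-2 * (μ + 1) - 1) * g y) := by
    intro y hy
    have hy0 : 0 < y := hd.trans hy
    have hyc : (y : ℂ) ≠ 0 := by exact_mod_cast hy0.ne'
    have e1 : (y ^ (-2 : ℝ)) ^ (-(1 / 2) : ℝ) = y := by
      rw [← Real.rpow_mul hy0.le]; norm_num
    have e2 : |(-2 * y ^ (-2 - 1 : ℝ))| = 2 * y ^ (-2 - 1 : ℝ) := by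
      rw [abs_mul, abs_of_pos (Real.rpow_pos_of_pos hy0 _)]; norm_num
    rw [e1, e2, Complex.real_smul, Complex.ofReal_mul, Complex.ofReal_cpow hy0.le,
      ofReal_rpow_cpow hy0]
    have e3 : (-2 * (μ + 1) - 1 : ℂ) = ((-2 - 1 : ℝ) : ℂ) + ((-2 : ℝ) : ℂ) * μ := by
      push_cast; ring
    rw [e3, Complex.cpow_add _ _ hyc]
    push_cast
    ring
  rw [← image_rpow_neg_two_Ioi hc]
  constructor
  · rw [integrableOn_image_iff_integrableOn_abs_deriv_smul measurableSet_Ioi hder hinj]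
    exact integrableOn_congr_fun e measurableSet_Ioi
  · rw [integral_image_eq_integral_abs_deriv_smul measurableSet_Ioi hder hinj,
      ← integral_const_mul]
    exact setIntegral_congr_fun measurableSet_Ioi e

/-- The boundary term `pₘ qₖ c ^ (ν + 1 - k / 2 + m) / (ν + 1 - k / 2 + m)`, at `x = (m, k)`, that
the terms `pₘ xᵐ` and `qₖ x ^ (-k / 2)` of the two expansions produce at the splitting point. -/
noncomputable def boundaryTerm (p q : ℕ → ℂ) (c : ℝ) (ν : ℂ) (x : ℕ × ℕ) : ℂ :=
  p x.1 * (q x.2 * ((c : ℂ) ^ (ν + 1 - x.2 / 2 + x.1) / (ν + 1 - x.2 / 2 + x.1)))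

theorem summable_boundaryTerm {p q : ℕ → ℂ} {c : ℝ} (hc : 0 < c) {ν : ℂ}
    (hν : ∀ n : ℤ, 2 * ν ≠ n) (hp : Summable fun m => ‖p m‖ * c ^ m)
    (hq : Summable fun k => ‖q k‖ * (c ^ (-(1 / 2) : ℝ)) ^ k) :
    Summable (boundaryTerm p q c ν) := by
  obtain ⟨δ, hδ, h⟩ := exists_pos_le_norm_add_intCast hν
  have hprod := hp.mul_of_nonneg hq (fun m => by positivity) (fun k => by positivity)
  refine Summable.of_norm_bounded (hprod.mul_right (c ^ (ν.re + 1) / (δ / 2))) ?_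
  rintro ⟨m, k⟩
  have hden : δ / 2 ≤ ‖ν + 1 - k / 2 + m‖ := by
    -- Twice the denominator is an integral shift of `2ν`.
    have h1 := h (2 + 2 * m - k)
    have e : 2 * ν + ((2 + 2 * m - k : ℤ) : ℂ) = 2 * (ν + 1 - k / 2 + m) := by
      push_cast; ring
    rw [e, norm_mul, Complex.norm_ofNat] at h1
    linarith
  have hnum : ‖(c : ℂ) ^ (ν + 1 - k / 2 + m)‖ =
      c ^ m * (c ^ (-(1 / 2) : ℝ)) ^ k * c ^ (ν.re + 1) := by
    rw [Complex.norm_cpow_eq_rpow_re_of_pos hc, ← Real.rpow_natCast, ← Real.rpow_natCast,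
      ← Real.rpow_mul hc.le, ← Real.rpow_add hc, ← Real.rpow_add hc]
    congr 1
    simp
    ring
  simp only [boundaryTerm]
  rw [norm_mul, norm_mul, norm_div, hnum]
  calc ‖p m‖ * (‖q k‖ * (c ^ m * (c ^ (-(1 / 2) : ℝ)) ^ k * c ^ (ν.re + 1) /
        ‖ν + 1 - k / 2 + m‖))
      ≤ ‖p m‖ * (‖q k‖ * (c ^ m * (c ^ (-(1 / 2) : ℝ)) ^ k * c ^ (ν.re + 1) / (δ / 2))) := by
        gcongr
    _ = _ := by ring

/-- If `2ν` is not an integer, then no `ν + j / 2` with `j` an integer is one. -/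
theorem ne_intCast_of_two_mul {s ν : ℂ} (hν : ∀ n : ℤ, 2 * ν ≠ n) {j : ℤ}
    (h : 2 * s = 2 * ν + j) (n : ℤ) : s ≠ n := by
  rintro rfl
  apply hν (2 * n - j)
  push_cast
  linear_combination -h

/-- The integrand after rescaling `x` so that `α - 1` becomes `1`. -/
noncomputable def scaledIntegrand (ν : ℂ) (β B x : ℝ) : ℂ :=
  (x : ℂ) ^ ν * (((1 + x) ^ (-β) : ℝ) : ℂ) * ((Real.exp (-B * x ^ (-(1 / 2) : ℝ)) : ℝ) : ℂ)

/-- On `(0, c)` the factor `(1 + x) ^ (-β)` is expanded; after `x = y ^ (-2)` each term is an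
incomplete gamma integral. -/
theorem hasSum_integral_scaledIntegrand_Ioo {ν : ℂ} {β B c : ℝ} (hB : 0 < B) (hc : 0 < c)
    (hc1 : c < 1) (hν : ∀ n : ℤ, 2 * ν ≠ n) :
    IntegrableOn (scaledIntegrand ν β B) (Ioo 0 c) ∧
    HasSum (fun m : ℕ => binCoeff β m * (2 * ((B : ℂ) ^ (2 * (ν + m + 1)) *
        Complex.Gamma (-2 * (ν + m + 1)))) +
        ∑' k : ℕ, boundaryTerm (binCoeff β) (expCoeff B) c ν (m, k))
      (∫ x in Ioo 0 c, scaledIntegrand ν β B x) := by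
  have hd : 0 < c ^ (-(1 / 2) : ℝ) := Real.rpow_pos_of_pos hc _
  set g : ℝ → ℂ := fun y => ((Real.exp (-B * y) : ℝ) : ℂ) with hg
  have hh : IntegrableOn (fun x : ℝ => (x : ℂ) ^ ν * g (x ^ (-(1 / 2) : ℝ))) (Ioo 0 c) :=
    (substitution_rpow_neg_two hc ν g).1.2 ((integrableOn_cpow_mul_exp hB hd _).const_mul 2)
  have hf : ContinuousOn (fun x : ℝ => (((1 + x) ^ (-β) : ℝ) : ℂ)) (Icc 0 c) := by
    refine Complex.continuous_ofReal.comp_continuousOn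
      (ContinuousOn.rpow_const (by fun_prop) fun x hx => Or.inl ?_)
    linarith [hx.1]
  have hfun : scaledIntegrand ν β B = fun x : ℝ =>
      (x : ℂ) ^ ν * g (x ^ (-(1 / 2) : ℝ)) * (((1 + x) ^ (-β) : ℝ) : ℂ) := by
    funext x
    rw [scaledIntegrand]
    ring
  rw [hfun]
  have key := hasSum_setIntegral_mul_pow measurableSet_Ioo hh measurable_id (M := c)
    (fun x hx => by simpa [abs_of_pos hx.1] using hx.2.le) (summable_norm_binCoeff β hc hc1)
    (fun x hx => hasSum_binCoeff β (by rw [id, abs_of_pos hx.1]; exact hx.2.trans hc1))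
  refine ⟨?_, ?_⟩
  · rw [← integrableOn_Ioc_iff_integrableOn_Ioo, ← integrableOn_Icc_iff_integrableOn_Ioc] at hh ⊢
    exact hh.mul_continuousOn hf isCompact_Icc
  · convert! key using 2 with m
    have hσ : ∀ n : ℤ, -2 * (ν + m + 1) ≠ n := by
      intro n hn
      apply hν (-n - 2 * m - 2)
      push_cast
      linear_combination -hn
    have e1 : ∫ x in Ioo 0 c, (x : ℂ) ^ ν * g (x ^ (-(1 / 2) : ℝ)) * ((id x : ℝ) : ℂ) ^ m =
        2 * ∫ y in Ioi (c ^ (-(1 / 2) : ℝ)), (y : ℂ) ^ (-2 * (ν + m + 1) - 1) * g y := by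
      rw [← (substitution_rpow_neg_two hc (ν + m) g).2]
      refine setIntegral_congr_fun measurableSet_Ioo fun x hx => ?_
      have hx0 : (x : ℂ) ≠ 0 := by exact_mod_cast hx.1.ne'
      simp only [id]
      rw [Complex.cpow_add _ _ hx0, Complex.cpow_natCast]
      ring
    have e2 := regMellin_exp hB hd hσ
    rw [regMellin] at e2
    have e2' : ∫ y in Ioi (c ^ (-(1 / 2) : ℝ)), (y : ℂ) ^ (-2 * (ν + m + 1) - 1) * g y = _ :=
      eq_sub_iff_add_eq'.2 e2
    have e3 : ∑' k : ℕ, boundaryTerm (binCoeff β) (expCoeff B) c ν (m, k) =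
        -(2 * binCoeff β m) * ∑' k : ℕ, expCoeff B k * (((c ^ (-(1 / 2) : ℝ) : ℝ) : ℂ) ^
          (-2 * (ν + m + 1) + k) / (-2 * (ν + m + 1) + k)) := by
      rw [← tsum_mul_left]
      refine tsum_congr fun k => ?_
      rw [boundaryTerm, ofReal_rpow_cpow hc]
      have h0 : ν + 1 - k / 2 + m ≠ 0 := by
        intro h
        apply hν (k - 2 * m - 2)
        push_cast
        linear_combination 2 * h
      have h1 : -2 * (ν + m + 1) + k = -2 * (ν + 1 - k / 2 + m) := by ring
      have h2 : ((-(1 / 2) : ℝ) : ℂ) * (-2 * (ν + 1 - k / 2 + m)) = ν + 1 - k / 2 + m := by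
        push_cast; ring
      simp only
      rw [h1, h2]
      field_simp
    rw [e1, e2', e3]
    ring_nf

/-- On `(c, ∞)` the exponential is expanded; each term is an incomplete beta integral. -/
theorem hasSum_integral_scaledIntegrand_Ioi {ν : ℂ} {β B c : ℝ} (hc : 0 < c) (hc1 : c < 1)
    (hB : 0 < B) (hν : ∀ n : ℤ, 2 * ν ≠ n) (hβ : 0 < β) (hνβ : ν.re + 1 < β) :
    IntegrableOn (scaledIntegrand ν β B) (Ioi c) ∧
    HasSum (fun k : ℕ => expCoeff B k * (Complex.Gamma (ν + 1 - k / 2) *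
        Complex.Gamma (β - (ν + 1 - k / 2)) / Complex.Gamma β) -
        ∑' m : ℕ, boundaryTerm (binCoeff β) (expCoeff B) c ν (m, k))
      (∫ x in Ioi c, scaledIntegrand ν β B x) := by
  have hh := integrableOn_cpow_mul_one_add_rpow hβ.le hc hνβ
  have hmeas : Measurable fun x : ℝ => x ^ (-(1 / 2) : ℝ) := by fun_prop
  have hM : ∀ x ∈ Ioi c, |x ^ (-(1 / 2) : ℝ)| ≤ c ^ (-(1 / 2) : ℝ) := by
    intro x hx
    have hx : c < x := hx
    rw [abs_of_pos (Real.rpow_pos_of_pos (hc.trans hx) _)]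
    exact Real.rpow_le_rpow_of_nonpos hc hx.le (by norm_num)
  have key := hasSum_setIntegral_mul_pow measurableSet_Ioi hh hmeas hM
    (summable_norm_expCoeff B _) (fun x _ => hasSum_expCoeff B _)
  refine ⟨?_, ?_⟩
  · refine Integrable.mul_bdd (c := 1) hh
      (Complex.measurable_ofReal.comp (Real.measurable_exp.comp
        (hmeas.const_mul (-B)))).aestronglyMeasurable
      ((ae_restrict_mem measurableSet_Ioi).mono fun x hx => ?_)
    have hx0 : 0 < x ^ (-(1 / 2) : ℝ) := Real.rpow_pos_of_pos (hc.trans hx) _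
    rw [Complex.norm_real, Real.norm_eq_abs, abs_of_pos (Real.exp_pos _), Real.exp_le_one_iff]
    nlinarith
  · convert! key using 2 with k
    have hs : ∀ n : ℤ, ν + 1 - k / 2 ≠ n :=
      ne_intCast_of_two_mul hν (j := 2 - k) (by push_cast; ring)
    have hsβ : (ν + 1 - k / 2).re < β := by
      have : (0 : ℝ) ≤ k := by positivity
      simp
      linarith
    have e1 : ∫ x in Ioi c, (x : ℂ) ^ ν * (((1 + x) ^ (-β) : ℝ) : ℂ) *
        ((x ^ (-(1 / 2) : ℝ) : ℝ) : ℂ) ^ k =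
        ∫ x in Ioi c, (x : ℂ) ^ (ν + 1 - k / 2 - 1) * (((1 + x) ^ (-β) : ℝ) : ℂ) := by
      refine setIntegral_congr_fun measurableSet_Ioi fun x hx => ?_
      have hx1 : 0 < x := hc.trans hx
      have hx0 : (x : ℂ) ≠ 0 := by exact_mod_cast hx1.ne'
      rw [← Complex.cpow_natCast, ofReal_rpow_cpow hx1,
        show ν + 1 - k / 2 - 1 = ν + ((-(1 / 2) : ℝ) : ℂ) * k by push_cast; ring,
        Complex.cpow_add _ _ hx0]
      ring
    have e2 := regMellin_one_add_rpow hc hc1 hβ hs hsβ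
    rw [regMellin] at e2
    rw [e1, ← e2, mul_add, ← tsum_mul_left, add_sub_assoc, add_comm, sub_add_eq_add_sub]
    have e3 : ∑' m : ℕ, boundaryTerm (binCoeff β) (expCoeff B) c ν (m, k) =
      ∑' m : ℕ, expCoeff B k * (binCoeff β m * ((c : ℂ) ^ (ν + 1 - k / 2 + m) /
        (ν + 1 - k / 2 + m))) := tsum_congr fun m => by rw [boundaryTerm]; ring
    rw [e3]
    ring

/-- The boundary terms produced at the splitting point on the two sides cancel, which leaves
the two series of complete gamma and beta values. -/
theorem integral_scaledIntegrand {ν : ℂ} {β B : ℝ} (hB : 0 < B)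
    (hν : ∀ n : ℤ, 2 * ν ≠ n) (hβ : 0 < β) (hνβ : ν.re + 1 < β) :
    IntegrableOn (scaledIntegrand ν β B) (Ioi 0) ∧
    ∃ U V : ℂ, HasSum (fun m : ℕ => binCoeff β m * (2 * ((B : ℂ) ^ (2 * (ν + m + 1)) *
        Complex.Gamma (-2 * (ν + m + 1))))) U ∧
      HasSum (fun k : ℕ => expCoeff B k * (Complex.Gamma (ν + 1 - k / 2) *
        Complex.Gamma (β - (ν + 1 - k / 2)) / Complex.Gamma β)) V ∧
      ∫ x in Ioi (0 : ℝ), scaledIntegrand ν β B x = U + V := by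
  obtain ⟨c, hc, hc1⟩ : ∃ c : ℝ, 0 < c ∧ c < 1 := ⟨1 / 2, by norm_num, by norm_num⟩
  obtain ⟨i1, s1⟩ := hasSum_integral_scaledIntegrand_Ioo (β := β) hB hc hc1 hν
  obtain ⟨i2, s2⟩ := hasSum_integral_scaledIntegrand_Ioi hc hc1 hB hν hβ hνβ
  have hD := summable_boundaryTerm hc hν (summable_norm_binCoeff β hc hc1)
    (summable_norm_expCoeff B _)
  have t1 := hD.hasSum.prod_fiberwise fun m => (hD.prod_factor m).hasSum
  have t2 := ((Equiv.prodComm ℕ ℕ).hasSum_iff.2 hD.hasSum).prod_fiberwise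
    fun k => (((Equiv.prodComm ℕ ℕ).summable_iff.2 hD).prod_factor k).hasSum
  have i1' : IntegrableOn (scaledIntegrand ν β B) (Ioc 0 c) :=
    (integrableOn_Ioc_iff_integrableOn_Ioo (by finiteness)).2 i1
  refine ⟨?_, _, _, by simpa using s1.sub t1, by simpa using s2.add t2, ?_⟩
  · rw [← Ioc_union_Ioi_eq_Ioi hc.le]
    exact i1'.union i2
  · rw [← Ioc_union_Ioi_eq_Ioi hc.le, setIntegral_union Ioc_disjoint_Ioi_same measurableSet_Ioi
      i1' i2, integral_Ioc_eq_integral_Ioo]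
    ring

/-! ### Gamma values as Pochhammer symbols -/

/-- Shifting the argument of `Γ` down by `r`. -/
theorem Gamma_sub_natCast {z : ℂ} (hz : ∀ n : ℤ, z ≠ n) (r : ℕ) :
    Complex.Gamma (z - r) =
      (-1) ^ r * Complex.Gamma z / (ascPochhammer ℂ r).eval (1 - z) := by
  have hne : ∀ k : ℕ, z - k - 1 ≠ 0 := by
    intro k h
    apply hz (k + 1)
    push_cast
    linear_combination h
  have hp : ∀ r : ℕ, (ascPochhammer ℂ r).eval (1 - z) ≠ 0 := by
    intro r
    induction r with
    | zero => simp
    | succ r ih =>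
      rw [ascPochhammer_succ_eval]
      refine mul_ne_zero ih fun h => hne r ?_
      linear_combination -h
  induction r with
  | zero => simp
  | succ r ih =>
    have h := Complex.Gamma_add_one _ (hne r)
    rw [sub_add_cancel, ih] at h
    have h1 := hp r
    have h2 := hp (r + 1)
    rw [ascPochhammer_succ_eval] at h2 ⊢
    push_cast
    rw [← sub_sub]
    rw [eq_div_iff h2]
    rw [div_eq_iff h1] at h
    linear_combination h

theorem Gamma_add_natCast {z : ℂ} (hz : 0 < z.re) (r : ℕ) :
    Complex.Gamma (z + r) = (ascPochhammer ℂ r).eval z * Complex.Gamma z := by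
  rw [← Complex.Gamma_add_nat_div_Gamma_eq z,
    div_mul_cancel₀ _ (Complex.Gamma_ne_zero_of_re_pos hz)]
  rintro k rfl
  have : (0 : ℝ) ≤ k := by positivity
  simp at hz
  linarith

theorem ascPochhammer_eval_ne_zero_of_re_pos {z : ℂ} (hz : 0 < z.re) (r : ℕ) :
    (ascPochhammer ℂ r).eval z ≠ 0 := by
  intro h
  have := Gamma_add_natCast hz r
  rw [h, zero_mul] at this
  refine Complex.Gamma_ne_zero_of_re_pos ?_ this
  rw [Complex.add_re, Complex.natCast_re]
  positivity

theorem factorial_two_mul_eq (r : ℕ) :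
    (((2 * r).factorial : ℕ) : ℂ) =
      4 ^ r * r.factorial * (ascPochhammer ℂ r).eval (1 / 2) := by
  induction r with
  | zero => simp
  | succ r ih =>
    rw [show 2 * (r + 1) = 2 * r + 1 + 1 by ring, Nat.factorial_succ, Nat.factorial_succ,
      Nat.factorial_succ, ascPochhammer_succ_eval]
    push_cast
    rw [ih]
    ring

theorem factorial_two_mul_add_one_eq (r : ℕ) :
    (((2 * r + 1).factorial : ℕ) : ℂ) =
      4 ^ r * r.factorial * (ascPochhammer ℂ r).eval (3 / 2) := by
  induction r with
  | zero => simp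
  | succ r ih =>
    rw [show 2 * (r + 1) + 1 = 2 * r + 1 + 1 + 1 by ring,
      Nat.factorial_succ (2 * r + 1 + 1), Nat.factorial_succ (2 * r + 1), Nat.factorial_succ r,
      ascPochhammer_succ_eval]
    push_cast
    rw [ih]
    ring

/-! ### Identification with the hypergeometric terms -/

/-- The beta values of even index are, up to a constant, the terms of the first `₁F₂`. -/
theorem even_term_eq {ν : ℂ} {β B : ℝ} (hν : ∀ n : ℤ, 2 * ν ≠ n) (hνβ : ν.re + 1 < β) (r : ℕ) :
    expCoeff B (2 * r) * (Complex.Gamma (ν + 1 - (2 * r : ℕ) / 2) *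
        Complex.Gamma (β - (ν + 1 - (2 * r : ℕ) / 2)) / Complex.Gamma β) =
      Complex.Gamma (β - 1 - ν) * Complex.Gamma (1 + ν) / Complex.Gamma β *
        oneFTwoTerm (β - 1 - ν) (1 / 2) (-ν) (-((B : ℂ) ^ 2 / 4)) r := by
  have hz : ∀ n : ℤ, 1 + ν ≠ n :=
    ne_intCast_of_two_mul hν (j := 2) (by push_cast; ring)
  have hre : 0 < (β - 1 - ν : ℂ).re := by simp; linarith
  have h1 : ν + 1 - (2 * r : ℕ) / 2 = 1 + ν - r := by push_cast; ring
  have h2 : (β : ℂ) - (1 + ν - r) = β - 1 - ν + r := by ring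
  have h3 : 1 - (1 + ν) = -ν := by ring
  have h4 : (ascPochhammer ℂ r).eval (1 / 2 : ℂ) ≠ 0 :=
    ascPochhammer_eval_ne_zero_of_re_pos (by norm_num) r
  have h5 : (r.factorial : ℂ) ≠ 0 := by exact_mod_cast r.factorial_ne_zero
  rw [h1, h2, Gamma_sub_natCast hz, Gamma_add_natCast hre, h3, expCoeff, factorial_two_mul_eq,
    oneFTwoTerm, pow_mul, neg_sq, neg_pow ((B : ℂ) ^ 2 / 4), div_pow]
  field_simp

/-- The beta values of odd index are, up to a constant, the terms of the second `₁F₂`. -/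
theorem odd_term_eq {ν : ℂ} {β B : ℝ} (hν : ∀ n : ℤ, 2 * ν ≠ n) (hνβ : ν.re + 1 < β) (r : ℕ) :
    expCoeff B (2 * r + 1) * (Complex.Gamma (ν + 1 - (2 * r + 1 : ℕ) / 2) *
        Complex.Gamma (β - (ν + 1 - (2 * r + 1 : ℕ) / 2)) / Complex.Gamma β) =
      -(Complex.Gamma (β - 1 / 2 - ν) * Complex.Gamma (1 / 2 + ν) / Complex.Gamma β * B) *
        oneFTwoTerm (β - 1 / 2 - ν) (3 / 2) (1 / 2 - ν) (-((B : ℂ) ^ 2 / 4)) r := by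
  have hz : ∀ n : ℤ, 1 / 2 + ν ≠ n :=
    ne_intCast_of_two_mul hν (j := 1) (by push_cast; ring)
  have hre : 0 < (β - 1 / 2 - ν : ℂ).re := by simp; linarith
  have h1 : ν + 1 - (2 * r + 1 : ℕ) / 2 = 1 / 2 + ν - r := by push_cast; ring
  have h2 : (β : ℂ) - (1 / 2 + ν - r) = β - 1 / 2 - ν + r := by ring
  have h3 : 1 - (1 / 2 + ν) = 1 / 2 - ν := by ring
  have h4 : (ascPochhammer ℂ r).eval (3 / 2 : ℂ) ≠ 0 :=
    ascPochhammer_eval_ne_zero_of_re_pos (by norm_num) r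
  have h5 : (r.factorial : ℂ) ≠ 0 := by exact_mod_cast r.factorial_ne_zero
  rw [h1, h2, Gamma_sub_natCast hz, Gamma_add_natCast hre, h3, expCoeff,
    factorial_two_mul_add_one_eq, oneFTwoTerm, pow_succ, pow_mul, neg_sq,
    neg_pow ((B : ℂ) ^ 2 / 4), div_pow]
  field_simp

/-- The terms coming from `(0, c)` are, up to a constant, those of the third `₁F₂`: Legendre's
duplication formula splits their gamma value into the two Pochhammer denominators. -/
theorem gamma_term_eq {ν : ℂ} {β B : ℝ} (hB : 0 < B) (hν : ∀ n : ℤ, 2 * ν ≠ n) (m : ℕ) :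
    binCoeff β m * (2 * ((B : ℂ) ^ (2 * (ν + m + 1)) * Complex.Gamma (-2 * (ν + m + 1)))) =
      (Real.pi : ℂ) ^ (-(1 / 2) : ℂ) * Complex.Gamma (-ν - 1) * Complex.Gamma (-ν - 1 / 2) *
          ((B : ℂ) ^ 2 / 4) ^ (1 + ν) *
        oneFTwoTerm β (2 + ν) (3 / 2 + ν) (-((B : ℂ) ^ 2 / 4)) m := by
  have hB0 : (B : ℂ) ≠ 0 := by exact_mod_cast hB.ne'
  have hz1 : ∀ n : ℤ, -ν - 1 ≠ n := by
    intro n hn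
    apply hν (-2 * n - 2)
    push_cast
    linear_combination -2 * hn
  have hz2 : ∀ n : ℤ, -ν - 1 / 2 ≠ n := by
    intro n hn
    apply hν (-2 * n - 1)
    push_cast
    linear_combination -2 * hn
  have hdup := Complex.Gamma_mul_Gamma_add_half (-(ν + m + 1))
  have h1 : -(ν + m + 1) = -ν - 1 - m := by ring
  have h2 : -ν - 1 - m + 1 / 2 = -ν - 1 / 2 - m := by ring
  have h3 : 1 - (-ν - 1) = 2 + ν := by ring
  have h4 : 1 - (-ν - 1 / 2) = 3 / 2 + ν := by ring
  have h5 : 2 * -(ν + m + 1) = -2 * (ν + m + 1) := by ring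
  rw [h5, h1, h2, Gamma_sub_natCast hz1, Gamma_sub_natCast hz2, h3, h4] at hdup
  have hpi : (Real.pi : ℂ) ^ (-(1 / 2) : ℂ) = ((√Real.pi : ℝ) : ℂ)⁻¹ := by
    rw [Complex.cpow_neg, Real.sqrt_eq_rpow, Complex.ofReal_cpow Real.pi_pos.le]
    norm_num
  have hpi0 : ((√Real.pi : ℝ) : ℂ) ≠ 0 := by
    exact_mod_cast (Real.sqrt_pos.2 Real.pi_pos).ne'
  have hpow : ((B : ℂ) ^ 2 / 4) ^ (1 + ν) * (2 : ℂ) ^ (2 * (1 + ν)) = (B : ℂ) ^ (2 * (1 + ν)) := by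
    have e1 : ((B : ℂ) ^ 2 / 4) = (((B / 2) ^ (2 : ℝ) : ℝ) : ℂ) := by
      rw [Real.rpow_two]; push_cast; ring
    have e2 : (B : ℂ) = ((B / 2 * 2 : ℝ) : ℂ) := by push_cast; ring
    rw [e1, ofReal_rpow_cpow (by positivity), e2, Complex.ofReal_mul,
      Complex.mul_cpow_ofReal_nonneg (by positivity) (by positivity)]
    push_cast
    ring_nf
  have h6 : (B : ℂ) ^ (2 * (ν + m + 1)) = (B : ℂ) ^ (2 * (1 + ν)) * ((B : ℂ) ^ 2) ^ m := by
    rw [← pow_mul, ← Complex.cpow_natCast (B : ℂ) (2 * m), ← Complex.cpow_add _ _ hB0]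
    push_cast
    ring_nf
  have h7 : (2 : ℂ) ^ (1 - -2 * (ν + m + 1)) = 2 * 2 ^ (2 * (1 + ν)) * 4 ^ m := by
    rw [show (1 - -2 * (ν + m + 1) : ℂ) = 1 + 2 * (1 + ν) + ((2 * m : ℕ) : ℂ) by push_cast; ring,
      Complex.cpow_add _ _ two_ne_zero, Complex.cpow_add _ _ two_ne_zero, Complex.cpow_one,
      Complex.cpow_natCast, pow_mul]
    norm_num
  have h8 : (2 : ℂ) ^ (2 * (1 + ν)) ≠ 0 := by simp [Complex.cpow_eq_zero_iff]
  have hsq : ((-1 : ℂ) ^ m) * (-1) ^ m = 1 := by rw [← mul_pow]; norm_num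
  have hG : Complex.Gamma (-2 * (ν + m + 1)) =
      Complex.Gamma (-ν - 1) * Complex.Gamma (-ν - 1 / 2) /
        ((ascPochhammer ℂ m).eval (2 + ν) * (ascPochhammer ℂ m).eval (3 / 2 + ν)) /
        (2 * 2 ^ (2 * (1 + ν)) * 4 ^ m * ((√Real.pi : ℝ) : ℂ)) := by
    rw [h7] at hdup
    have hden : (2 : ℂ) * 2 ^ (2 * (1 + ν)) * 4 ^ m * ((√Real.pi : ℝ) : ℂ) ≠ 0 :=
      mul_ne_zero (mul_ne_zero (mul_ne_zero two_ne_zero h8) (by simp)) hpi0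
    rw [eq_div_iff hden]
    linear_combination -hdup + Complex.Gamma (-ν - 1) * Complex.Gamma (-ν - 1 / 2) /
      ((ascPochhammer ℂ m).eval (2 + ν) * (ascPochhammer ℂ m).eval (3 / 2 + ν)) * hsq
  rw [hG, h6, ← hpow, hpi, binCoeff, oneFTwoTerm, neg_pow ((B : ℂ) ^ 2 / 4), div_pow]
  field_simp

/-! ### Evaluation by hypergeometric series -/

/-- Rescaling by `a = α - 1`: the exponential is unchanged because `B = b √a`. -/
theorem extendedIntegrand_eq_scaledIntegrand {a b : ℝ} (ha : 0 < a) (ν : ℂ) {x : ℝ}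
    (hx : 0 < x) :
    extendedIntegrand ν (1 + a) b x =
      (a : ℂ) ^ (-ν) * scaledIntegrand ν (1 / a) (b * √a) (a * x) := by
  have ha0 : (a : ℂ) ≠ 0 := by exact_mod_cast ha.ne'
  have hcancel : (a : ℂ) ^ (-ν) * (a : ℂ) ^ ν = 1 := by
    rw [← Complex.cpow_add _ _ ha0, neg_add_cancel, Complex.cpow_zero]
  have hexp : -(b * √a) * (a * x) ^ (-(1 / 2) : ℝ) = -b * x ^ (-(1 / 2) : ℝ) := by
    rw [Real.mul_rpow ha.le hx.le, Real.rpow_neg ha.le, ← Real.sqrt_eq_rpow]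
    have := (Real.sqrt_pos.2 ha).ne'
    field_simp
  rw [extendedIntegrand, scaledIntegrand, hexp, add_sub_cancel_left, Complex.ofReal_mul,
    Complex.mul_cpow_ofReal_nonneg ha.le hx.le]
  linear_combination -(x : ℂ) ^ ν * (((1 + a * x) ^ (-(1 / a)) : ℝ) : ℂ) *
    ((Real.exp (-b * x ^ (-(1 / 2) : ℝ)) : ℝ) : ℂ) * hcancel

theorem integral_scaledIntegrand_eq_oneFTwo {ν : ℂ} {β B : ℝ} (hB : 0 < B)
    (hν : ∀ n : ℤ, 2 * ν ≠ n) (hβ : 0 < β) (hνβ : ν.re + 1 < β) :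
    IntegrableOn (scaledIntegrand ν β B) (Ioi 0) ∧
    Summable (oneFTwoTerm (β - 1 - ν) (1 / 2) (-ν) (-((B : ℂ) ^ 2 / 4))) ∧
    Summable (oneFTwoTerm (β - 1 / 2 - ν) (3 / 2) (1 / 2 - ν) (-((B : ℂ) ^ 2 / 4))) ∧
    Summable (oneFTwoTerm β (2 + ν) (3 / 2 + ν) (-((B : ℂ) ^ 2 / 4))) ∧
    ∫ x in Ioi (0 : ℝ), scaledIntegrand ν β B x =
      Complex.Gamma (β - 1 - ν) * Complex.Gamma (1 + ν) / Complex.Gamma β *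
          oneFTwo (β - 1 - ν) (1 / 2) (-ν) (-((B : ℂ) ^ 2 / 4)) -
        Complex.Gamma (β - 1 / 2 - ν) * Complex.Gamma (1 / 2 + ν) / Complex.Gamma β * B *
          oneFTwo (β - 1 / 2 - ν) (3 / 2) (1 / 2 - ν) (-((B : ℂ) ^ 2 / 4)) +
        (Real.pi : ℂ) ^ (-(1 / 2) : ℂ) * Complex.Gamma (-ν - 1) * Complex.Gamma (-ν - 1 / 2) *
          ((B : ℂ) ^ 2 / 4) ^ (1 + ν) *
          oneFTwo β (2 + ν) (3 / 2 + ν) (-((B : ℂ) ^ 2 / 4)) := by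
  obtain ⟨hint, U, V, hU, hV, hUV⟩ := integral_scaledIntegrand hB hν hβ hνβ
  have hB0 : (B : ℂ) ≠ 0 := by exact_mod_cast hB.ne'
  -- The constants `k1`, `k2`, `k3` in front of the series are nonzero, so the series `₁F₂` converge
  -- because `hU` and `hV` do.
  have hΓ : ∀ {z : ℂ} {j : ℤ}, 2 * z = 2 * ν + j ∨ 2 * z = -2 * ν + j →
      Complex.Gamma z ≠ 0 := by
    rintro z j h
    refine Complex.Gamma_ne_zero fun m hm => ?_
    rw [hm] at h
    rcases h with h | h
    · apply hν (-2 * m - j)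
      push_cast
      linear_combination -h
    · apply hν (2 * m + j)
      push_cast
      linear_combination h
  have hβΓ : Complex.Gamma β ≠ 0 := Complex.Gamma_ne_zero_of_re_pos (by simpa using hβ)
  have k1 : Complex.Gamma (β - 1 - ν) * Complex.Gamma (1 + ν) / Complex.Gamma β ≠ 0 :=
    div_ne_zero (mul_ne_zero (Complex.Gamma_ne_zero_of_re_pos (by simp; linarith))
      (hΓ (j := 2) (Or.inl (by push_cast; ring)))) hβΓ
  have k2 : -(Complex.Gamma (β - 1 / 2 - ν) * Complex.Gamma (1 / 2 + ν) / Complex.Gamma β * B)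
      ≠ 0 :=
    neg_ne_zero.2 (mul_ne_zero (div_ne_zero (mul_ne_zero
      (Complex.Gamma_ne_zero_of_re_pos (by simp; linarith))
      (hΓ (j := 1) (Or.inl (by push_cast; ring)))) hβΓ) hB0)
  have k3 : (Real.pi : ℂ) ^ (-(1 / 2) : ℂ) * Complex.Gamma (-ν - 1) *
      Complex.Gamma (-ν - 1 / 2) * ((B : ℂ) ^ 2 / 4) ^ (1 + ν) ≠ 0 := by
    refine mul_ne_zero (mul_ne_zero (mul_ne_zero ?_ (hΓ (j := -2) (Or.inr (by push_cast; ring))))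
      (hΓ (j := -1) (Or.inr (by push_cast; ring)))) ?_
    · simp [Complex.cpow_eq_zero_iff, Real.pi_ne_zero]
    · simp [Complex.cpow_eq_zero_iff, hB0]
  have hev := hV.summable.comp_injective (i := fun r : ℕ => 2 * r)
    (fun _ _ h => by simpa using h)
  have hod := hV.summable.comp_injective (i := fun r : ℕ => 2 * r + 1)
    (fun _ _ h => by simpa using h)
  have hsplit := hev.hasSum.even_add_odd (f := fun k : ℕ => expCoeff B k *
    (Complex.Gamma (ν + 1 - k / 2) * Complex.Gamma (β - (ν + 1 - k / 2)) / Complex.Gamma β))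
    hod.hasSum
  simp only [Function.comp_def, even_term_eq hν hνβ, odd_term_eq hν hνβ] at hev hod hsplit
  simp only [gamma_term_eq hB hν] at hU
  refine ⟨hint, (summable_mul_left_iff k1).1 hev, (summable_mul_left_iff k2).1 hod,
    (summable_mul_left_iff k3).1 hU.summable, ?_⟩
  rw [hUV, hV.unique hsplit, ← hU.tsum_eq, tsum_mul_left, tsum_mul_left, tsum_mul_left, oneFTwo,
    oneFTwo, oneFTwo]
  ring

theorem mainTheorem1 (ν : ℂ) (α b : ℝ) (hb : 0 < b) (hα : 1 < α)
    (hν : ∀ l : ℕ, ν ≠ (l : ℂ) / 2 ∧ ν ≠ -((l : ℂ) / 2))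
    (hconv : ν.re + 1 < 1 / (α - 1)) :
    MeasureTheory.IntegrableOn (extendedIntegrand ν α b) (Set.Ioi 0) ∧
    Summable (oneFTwoTerm (1 / ((α : ℂ) - 1) - 1 - ν) (1 / 2) (-ν)
      (-(((α : ℂ) - 1) * (b : ℂ) ^ 2 / 4))) ∧
    Summable (oneFTwoTerm (1 / ((α : ℂ) - 1) - 1 / 2 - ν) (3 / 2) (1 / 2 - ν)
      (-(((α : ℂ) - 1) * (b : ℂ) ^ 2 / 4))) ∧
    Summable (oneFTwoTerm (1 / ((α : ℂ) - 1)) (2 + ν) (3 / 2 + ν)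
      (-(((α : ℂ) - 1) * (b : ℂ) ^ 2 / 4))) ∧
    ∫ x in Set.Ioi (0 : ℝ), extendedIntegrand ν α b x =
      Complex.Gamma (1 / ((α : ℂ) - 1) - 1 - ν) * Complex.Gamma (1 + ν) /
          (((α : ℂ) - 1) ^ (ν + 1) * Complex.Gamma (1 / ((α : ℂ) - 1))) *
        oneFTwo (1 / ((α : ℂ) - 1) - 1 - ν) (1 / 2) (-ν)
          (-(((α : ℂ) - 1) * (b : ℂ) ^ 2 / 4))
      - 2 * Complex.Gamma (1 / ((α : ℂ) - 1) - 1 / 2 - ν) * Complex.Gamma (1 / 2 + ν) /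
          (((α : ℂ) - 1) ^ (ν + 1) * Complex.Gamma (1 / ((α : ℂ) - 1))) *
        (((α : ℂ) - 1) * (b : ℂ) ^ 2 / 4) ^ (1 / 2 : ℂ) *
        oneFTwo (1 / ((α : ℂ) - 1) - 1 / 2 - ν) (3 / 2) (1 / 2 - ν)
          (-(((α : ℂ) - 1) * (b : ℂ) ^ 2 / 4))
      + (Real.pi : ℂ) ^ (-(1 / 2) : ℂ) * Complex.Gamma (-ν - 1) *
            Complex.Gamma (-ν - 1 / 2) /
          ((α : ℂ) - 1) ^ (ν + 1) *
        (((α : ℂ) - 1) * (b : ℂ) ^ 2 / 4) ^ (1 + ν) *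
        oneFTwo (1 / ((α : ℂ) - 1)) (2 + ν) (3 / 2 + ν)
          (-(((α : ℂ) - 1) * (b : ℂ) ^ 2 / 4)) := by
  obtain ⟨a, rfl⟩ : ∃ a, α = 1 + a := ⟨α - 1, by ring⟩
  have ha : 0 < a := by linarith
  have ha0 : (a : ℂ) ≠ 0 := by exact_mod_cast ha.ne'
  have hB : 0 < b * √a := mul_pos hb (Real.sqrt_pos.2 ha)
  have hν' : ∀ n : ℤ, 2 * ν ≠ n := by
    intro n hn
    obtain ⟨l, rfl | rfl⟩ := n.eq_nat_or_neg
    · apply (hν l).1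
      push_cast at hn
      linear_combination hn / 2
    · apply (hν l).2
      push_cast at hn
      linear_combination hn / 2
  rw [add_sub_cancel_left] at hconv
  have hac : ((1 + a : ℝ) : ℂ) - 1 = a := by push_cast; ring
  have hβ : ((1 / a : ℝ) : ℂ) = 1 / (a : ℂ) := by push_cast; ring
  have hz : ((b * √a : ℝ) : ℂ) ^ 2 / 4 = (a : ℂ) * (b : ℂ) ^ 2 / 4 := by
    rw [← Complex.ofReal_pow, mul_pow, Real.sq_sqrt ha.le]
    push_cast
    ring
  have hroot : ((a : ℂ) * (b : ℂ) ^ 2 / 4) ^ (1 / 2 : ℂ) = ((b * √a : ℝ) : ℂ) / 2 := by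
    have e1 : (a : ℂ) * (b : ℂ) ^ 2 / 4 = (((b * √a / 2) ^ (2 : ℝ) : ℝ) : ℂ) := by
      rw [← hz, Real.rpow_two]
      push_cast
      ring
    rw [e1, ofReal_rpow_cpow (by positivity)]
    push_cast
    norm_num
  obtain ⟨hint, s1, s2, s3, hI⟩ := integral_scaledIntegrand_eq_oneFTwo hB hν'
    (one_div_pos.2 ha) hconv
  rw [hβ, hz] at s1 s2 s3 hI
  rw [hac]
  have hcongr : EqOn (extendedIntegrand ν (1 + a) b)
      (fun x => (a : ℂ) ^ (-ν) * scaledIntegrand ν (1 / a) (b * √a) (a * x)) (Ioi 0) :=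
    fun x hx => extendedIntegrand_eq_scaledIntegrand ha ν hx
  refine ⟨?_, s1, s2, s3, ?_⟩
  · rw [integrableOn_congr_fun hcongr measurableSet_Ioi]
    refine Integrable.const_mul ?_ _
    have := (integrableOn_Ioi_comp_mul_left_iff (scaledIntegrand ν (1 / a) (b * √a)) 0 ha).2
      (by rwa [mul_zero])
    exact this
  · rw [setIntegral_congr_fun measurableSet_Ioi hcongr, integral_const_mul,
      integral_comp_mul_left_Ioi (fun x => scaledIntegrand ν (1 / a) (b * √a) x) 0 ha, mul_zero,
      hI, hroot, Complex.real_smul, Complex.ofReal_inv, Complex.cpow_neg,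
      Complex.cpow_add _ _ ha0, Complex.cpow_one]
    field_simp
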